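/- Let $(X,\mathcal A,\mu)$ be a measure space that is semi-finite, i.e. every $A\in\mathcal A$ with $\mu(A)=\infty$ contains some $B\in\mathcal A$ with $0<\mu(B)<\infty$. Let $L^1=L^1(\mu)$ and $L^\infty=L^\infty(\mu)$ be the usual real function spaces with the almost everywhere order, and let $(L^1)^\sim$ be the order dual of $L^1$: the space of all linear functionals on $L^1$ that are bounded on every order interval, ordered by $\alpha\le\beta$ if and only if $\alpha(f)\le\beta(f)$ for all $f\ge 0$ in $L^1$. Let $\Phi:L^\infty\to(L^1)^\sim$ be the linear map $h\mapsto\phi_h$, where $\phi_h(f)=\int fh\,d\mu$ for $f\in L^1$. Then $(L^1)^\sim$, with the embedding $\Phi$, is a Dedekind completion of the Riesz space $L^\infty$. That is: $(L^1)^\sim$ is a Dedekind complete Riesz space (every nonempty set that is bounded above has a supremum, and every nonempty set that is bounded below has an infimum), and $\Phi$ is an injective Riesz homomorphism whose range is a Riesz subspace of $(L^1)^\sim$ that is order dense (for every $\alpha>0$ in $(L^1)^\sim$ there is $h\in L^\infty$ with $0<\phi_h\le\alpha$) and majorizing (for every $\alpha\in(L^1)^\sim$ there is $h\in L^\infty$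 with $\alpha\le\phi_h$). Moreover, $\Phi$ is surjective if and only if $L^\infty$ is Dedekind complete. -/

import Mathlib

open MeasureTheory

noncomputable section

namespace RieszDual

/-! ### Riesz spaces, Riesz homomorphisms, Dedekind completions -/

/-- A real vector space with a partial order is a Riesz space (vector lattice) if the order is
compatible with the linear structure and any two elements have a supremum and an infimum. -/
structure IsRieszSpace (E : Type*) [AddCommGroup E] [Module ℝ E] [PartialOrder E] : Prop where
  add_le_add : ∀ a b c : E, a ≤ b → a + c ≤ b + c
  smul_nonneg : ∀ (r : ℝ) (a : E), 0 ≤ r → 0 ≤ a → 0 ≤ r • a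
  exists_sup : ∀ a b : E, ∃ s, IsLUB {a, b} s
  exists_inf : ∀ a b : E, ∃ s, IsGLB {a, b} s

/-- Every nonempty subset that is bounded above has a supremum, and every nonempty subset that is
bounded below has an infimum. -/
def IsDedekindComplete (E : Type*) [PartialOrder E] : Prop :=
  (∀ S : Set E, S.Nonempty → BddAbove S → ∃ s, IsLUB S s) ∧
    (∀ S : Set E, S.Nonempty → BddBelow S → ∃ s, IsGLB S s)

/-- A Riesz homomorphism: a linear map that preserves suprema and infima of pairs. -/
structure IsRieszHom {E F : Type*} [AddCommGroup E] [Module ℝ E] [PartialOrder E]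
    [AddCommGroup F] [Module ℝ F] [PartialOrder F] (T : E →ₗ[ℝ] F) : Prop where
  map_sup : ∀ a b s : E, IsLUB {a, b} s → IsLUB {T a, T b} (T s)
  map_inf : ∀ a b s : E, IsGLB {a, b} s → IsGLB {T a, T b} (T s)

/-- A Riesz subspace: a linear subspace that contains the suprema and infima, formed in the whole
space, of any two of its elements. -/
structure IsRieszSubspace {F : Type*} [AddCommGroup F] [Module ℝ F] [PartialOrder F]
    (S : Submodule ℝ F) : Prop where
  sup_mem : ∀ a ∈ S, ∀ b ∈ S, ∃ s ∈ S, IsLUB {a, b} s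
  inf_mem : ∀ a ∈ S, ∀ b ∈ S, ∃ s ∈ S, IsGLB {a, b} s

/-- `S` is order dense: below every `y > 0` there is an `x ∈ S` with `0 < x ≤ y`. -/
def IsOrderDense {F : Type*} [AddCommGroup F] [Module ℝ F] [PartialOrder F]
    (S : Submodule ℝ F) : Prop :=
  ∀ y : F, 0 < y → ∃ x ∈ S, 0 < x ∧ x ≤ y

/-- `S` is majorizing: every element of the space lies below an element of `S`. -/
def IsMajorizing {F : Type*} [AddCommGroup F] [Module ℝ F] [PartialOrder F]
    (S : Submodule ℝ F) : Prop :=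
  ∀ y : F, ∃ x ∈ S, y ≤ x

/-- `F`, with the embedding `T : E → F`, is a Dedekind completion of the Riesz space `E`:
`F` is a Dedekind complete Riesz space and `T` is an injective Riesz homomorphism onto an order
dense and majorizing Riesz subspace of `F`. -/
structure IsDedekindCompletion {E F : Type*} [AddCommGroup E] [Module ℝ E] [PartialOrder E]
    [AddCommGroup F] [Module ℝ F] [PartialOrder F] (T : E →ₗ[ℝ] F) : Prop where
  source_riesz : IsRieszSpace E
  target_riesz : IsRieszSpace F
  target_complete : IsDedekindComplete F
  injective : Function.Injective T
  riesz_hom : IsRieszHom T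
  range_riesz : IsRieszSubspace (LinearMap.range T)
  range_dense : IsOrderDense (LinearMap.range T)
  range_majorizing : IsMajorizing (LinearMap.range T)

/-! ### The order dual -/

/-- The order bounded linear functionals: those that map every order interval to a bounded set. -/
def orderBoundedFunctionals (E : Type*) [AddCommGroup E] [Module ℝ E] [PartialOrder E] :
    Submodule ℝ (E →ₗ[ℝ] ℝ) where
  carrier := {α | ∀ a b : E, ∃ C : ℝ, ∀ f ∈ Set.Icc a b, |α f| ≤ C}
  zero_mem' := fun _ _ => ⟨0, fun _ _ => by simp⟩
  add_mem' := by
    intro α β hα hβ a b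
    obtain ⟨C, hC⟩ := hα a b
    obtain ⟨D, hD⟩ := hβ a b
    exact ⟨C + D, fun f hf => (abs_add_le _ _).trans (add_le_add (hC f hf) (hD f hf))⟩
  smul_mem' := by
    intro r α hα a b
    obtain ⟨C, hC⟩ := hα a b
    refine ⟨|r| * C, fun f hf => ?_⟩
    rw [LinearMap.smul_apply, smul_eq_mul, abs_mul]
    exact mul_le_mul_of_nonneg_left (hC f hf) (abs_nonneg r)

/-- The order dual `E~` of a Riesz space `E`: the vector space of all order bounded linear
functionals on `E`. -/
def RieszOrderDual (E : Type*) [AddCommGroup E] [Module ℝ E] [PartialOrder E] : Type _ :=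
  ↥(orderBoundedFunctionals E)

instance (E : Type*) [AddCommGroup E] [Module ℝ E] [PartialOrder E] :
    AddCommGroup (RieszOrderDual E) :=
  inferInstanceAs (AddCommGroup ↥(orderBoundedFunctionals E))

instance (E : Type*) [AddCommGroup E] [Module ℝ E] [PartialOrder E] :
    Module ℝ (RieszOrderDual E) :=
  inferInstanceAs (Module ℝ ↥(orderBoundedFunctionals E))

/-- The usual order of `E~`: `α ≤ β` if and only if `α f ≤ β f` for all `f ≥ 0` in `E`. -/
instance (E : Type*) [AddCommGroup E] [Module ℝ E] [Lattice E] [IsOrderedAddMonoid E] :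
    PartialOrder (RieszOrderDual E) where
  le α β := ∀ f : E, 0 ≤ f → α.1 f ≤ β.1 f
  le_refl _ _ _ := le_rfl
  le_trans _ _ _ h₁ h₂ f hf := (h₁ f hf).trans (h₂ f hf)
  le_antisymm α β h₁ h₂ := by
    apply Subtype.ext
    ext f
    have key : ∀ g : E, 0 ≤ g → α.1 g = β.1 g := fun g hg => le_antisymm (h₁ g hg) (h₂ g hg)
    rw [← posPart_sub_negPart f, map_sub, map_sub, key _ (posPart_nonneg f),
      key _ (negPart_nonneg f)]

/-! ### The map from `L^∞` to the order dual of `L^1` -/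

/-- A measure is semi-finite if every measurable set of infinite measure contains a measurable
subset of finite, nonzero measure. -/
def IsSemifinite {X : Type*} [MeasurableSpace X] (μ : Measure X) : Prop :=
  ∀ A : Set X, MeasurableSet A → μ A = ⊤ →
    ∃ B : Set X, MeasurableSet B ∧ B ⊆ A ∧ 0 < μ B ∧ μ B < ⊤

theorem integrable_mul {X : Type*} [MeasurableSpace X] {μ : Measure X}
    (f : Lp ℝ 1 μ) (h : Lp ℝ ⊤ μ) : Integrable (fun x => f x * h x) μ :=
  (L1.integrable_coeFn f).mul_of_top_left (Lp.memLp h)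

/-- The functional `φ_h(f) = ∫ f h dμ` on `L^1`. -/
def phiLinear {X : Type*} [MeasurableSpace X] (μ : Measure X) (h : Lp ℝ ⊤ μ) :
    Lp ℝ 1 μ →ₗ[ℝ] ℝ where
  toFun f := ∫ x, f x * h x ∂μ
  map_add' f g := by
    rw [← integral_add (integrable_mul f h) (integrable_mul g h)]
    refine integral_congr_ae ?_
    filter_upwards [Lp.coeFn_add f g] with x hx
    rw [hx, Pi.add_apply, add_mul]
  map_smul' r f := by
    rw [RingHom.id_apply, smul_eq_mul, ← integral_const_mul]
    refine integral_congr_ae ?_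
    filter_upwards [Lp.coeFn_smul r f] with x hx
    rw [hx, Pi.smul_apply, smul_eq_mul, mul_assoc]

theorem phiLinear_mem {X : Type*} [MeasurableSpace X] (μ : Measure X) (h : Lp ℝ ⊤ μ) :
    phiLinear μ h ∈ orderBoundedFunctionals (Lp ℝ 1 μ) := by
  intro a b
  refine ⟨∫ x, (|a x * h x| + |b x * h x|) ∂μ, fun f hf => ?_⟩
  refine (abs_integral_le_integral_abs).trans (integral_mono_ae (integrable_mul f h).abs
    ((integrable_mul a h).abs.add (integrable_mul b h).abs) ?_)
  filter_upwards [(Lp.coeFn_le a f).2 hf.1, (Lp.coeFn_le f b).2 hf.2] with x h₁ h₂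
  simp only [abs_mul, ← add_mul]
  refine mul_le_mul_of_nonneg_right ?_ (abs_nonneg _)
  exact (abs_le_max_abs_abs h₁ h₂).trans
    (max_le (le_add_of_nonneg_right (abs_nonneg _)) (le_add_of_nonneg_left (abs_nonneg _)))

/-- The linear map `Φ : L^∞ → (L^1)~`, `h ↦ φ_h`, where `φ_h(f) = ∫ f h dμ`. -/
def Phi {X : Type*} [MeasurableSpace X] (μ : Measure X) :
    Lp ℝ ⊤ μ →ₗ[ℝ] RieszOrderDual (Lp ℝ 1 μ) where
  toFun h := ⟨phiLinear μ h, phiLinear_mem μ h⟩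
  map_add' h j := by
    apply Subtype.ext
    ext f
    change ∫ x, f x * (h + j : Lp ℝ ⊤ μ) x ∂μ = (∫ x, f x * h x ∂μ) + ∫ x, f x * j x ∂μ
    rw [← integral_add (integrable_mul f h) (integrable_mul f j)]
    refine integral_congr_ae ?_
    filter_upwards [Lp.coeFn_add h j] with x hx
    rw [hx, Pi.add_apply, mul_add]
  map_smul' r h := by
    apply Subtype.ext
    ext f
    change ∫ x, f x * (r • h : Lp ℝ ⊤ μ) x ∂μ = r • ∫ x, f x * h x ∂μ
    rw [smul_eq_mul, ← integral_const_mul]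
    refine integral_congr_ae ?_
    filter_upwards [Lp.coeFn_smul r h] with x hx
    rw [hx, Pi.smul_apply, smul_eq_mul]
    ring

end RieszDual

end

/-!
The order dual of a Riesz space is a Dedekind complete Riesz space by the Riesz–Kantorovich
construction: the supremum of a set `S` of functionals takes at `f ≥ 0` the value
`sup (α₁ f₁ + ⋯ + αₙ fₙ)` over `αᵢ ∈ S` and decompositions `f = f₁ + ⋯ + fₙ` into nonnegative
elements, and it is additive because decompositions split (`DecompSum.split`). Suprema of pairs and
of arbitrary sets bounded above are both instances (`exists_isLUB_of_decompSum`).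

Semi-finiteness makes `Φ` an order embedding (`Phi_le_Phi_iff`); that `Φ` preserves suprema of
pairs follows by cutting `f` along `{h ≤ g}` (`isLUB_Phi_sup`).

Positive functionals on a Banach lattice are automatically bounded (`exists_bound_of_nonneg`). On
`L^1` this gives `α f ≤ C ∫ f` for `f ≥ 0`, so the constants in `L^∞` already majorize. For order
density, a functional `α > 0` is nonzero at the indicator of some `A` of finite measure. The
functional `g ↦ α (1_A g)` on `L^2` is positive, hence continuous, hence an inner product with some
`k ∈ L^2`; the bound `0 ≤ α ≤ C ∫` forces `0 ≤ k ≤ C` almost everywhere on `A`, and `h = 1_A k`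
satisfies `φ_h f = α (1_A f)`, so that `0 < φ_h ≤ α` (`exists_Phi_eq_on_finite`). This replaces
the Radon–Nikodym theorem.

If `Φ` is surjective, it is an order isomorphism and transports completeness to `L^∞`. Conversely,
if `L^∞` is Dedekind complete, order density shows that `α` is the image of `sup {h | Φ h ≤ α}`
(`surjective_of_isDedekindComplete`).
-/

namespace RieszDual

/-! ### The Riesz–Kantorovich construction of suprema in the order dual -/

section OrderDual

variable {E : Type*} [AddCommGroup E] [Module ℝ E] [Lattice E]

/-- `DecompSum S f r` says that `r = α₁ f₁ + ⋯ + αₙ fₙ` for some functionals `αᵢ ∈ S` and some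
decomposition `f = f₁ + ⋯ + fₙ` into nonnegative elements. -/
inductive DecompSum (S : Set (RieszOrderDual E)) : E → ℝ → Prop
  | nil : DecompSum S 0 0
  | cons {α : RieszOrderDual E} {f g : E} {r : ℝ} (hα : α ∈ S) (hf : 0 ≤ f)
      (h : DecompSum S g r) : DecompSum S (f + g) (α.1 f + r)

namespace DecompSum

variable {S : Set (RieszOrderDual E)}

theorem single {α : RieszOrderDual E} (hα : α ∈ S) {f : E} (hf : 0 ≤ f) :
    DecompSum S f (α.1 f) := by
  simpa using cons hα hf nil

theorem add {f g : E} {r s : ℝ} (h : DecompSum S f r) (h' : DecompSum S g s) :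
    DecompSum S (f + g) (r + s) := by
  induction h with
  | nil => simpa using h'
  | cons hα hf _ ih =>
    rw [add_assoc, add_assoc]
    exact cons hα hf ih

theorem smul [PosSMulMono ℝ E] {f : E} {r c : ℝ} (hc : 0 ≤ c) (h : DecompSum S f r) :
    DecompSum S (c • f) (c * r) := by
  induction h with
  | nil => simpa using nil
  | @cons α f g r hα hf _ ih =>
    have := cons hα (smul_nonneg hc hf) ih
    rwa [map_smul, smul_eq_mul, ← mul_add, ← smul_add] at this

end DecompSum

variable [IsOrderedAddMonoid E]

/-- A function that is additive and positively homogeneous on the positive cone of a Riesz space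
agrees there with a linear functional. -/
theorem exists_linearMap_of_additive_on_cone (σ : E → ℝ) [PosSMulMono ℝ E]
    (hadd : ∀ f g, 0 ≤ f → 0 ≤ g → σ (f + g) = σ f + σ g)
    (hsmul : ∀ (c : ℝ) f, 0 ≤ c → 0 ≤ f → σ (c • f) = c * σ f) :
    ∃ L : E →ₗ[ℝ] ℝ, ∀ f, 0 ≤ f → L f = σ f := by
  -- The value `σ a - σ b` depends only on `a - b`.
  have key : ∀ a b : E, 0 ≤ a → 0 ≤ b → σ (a - b)⁺ - σ (a - b)⁻ = σ a - σ b := by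
    intro a b ha hb
    have h : (a - b)⁺ + b = a + (a - b)⁻ := by
      have := posPart_sub_negPart (a - b)
      rw [sub_eq_sub_iff_add_eq_add] at this
      exact this
    have h' := congrArg σ h
    rw [hadd _ _ (posPart_nonneg _) hb, hadd _ _ ha (negPart_nonneg _)] at h'
    linarith
  refine ⟨{ toFun := fun f => σ f⁺ - σ f⁻, map_add' := ?_, map_smul' := ?_ }, ?_⟩
  · intro f g
    have h : f + g = (f⁺ + g⁺) - (f⁻ + g⁻) := by
      rw [add_sub_add_comm, posPart_sub_negPart, posPart_sub_negPart]
    rw [h, key _ _ (add_nonneg (posPart_nonneg _) (posPart_nonneg _))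
      (add_nonneg (negPart_nonneg _) (negPart_nonneg _)),
      hadd _ _ (posPart_nonneg _) (posPart_nonneg _),
      hadd _ _ (negPart_nonneg _) (negPart_nonneg _)]
    ring
  · intro c f
    rw [RingHom.id_apply, smul_eq_mul]
    rcases le_total 0 c with hc | hc
    · have h : c • f = c • f⁺ - c • f⁻ := by rw [← smul_sub, posPart_sub_negPart]
      rw [h, key _ _ (smul_nonneg hc (posPart_nonneg _)) (smul_nonneg hc (negPart_nonneg _)),
        hsmul _ _ hc (posPart_nonneg _), hsmul _ _ hc (negPart_nonneg _)]
      ring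
    · have hc' : 0 ≤ -c := neg_nonneg.2 hc
      have h : c • f = (-c) • f⁻ - (-c) • f⁺ := by
        rw [← smul_sub, neg_smul, ← smul_neg, neg_sub, posPart_sub_negPart]
      rw [h, key _ _ (smul_nonneg hc' (negPart_nonneg _)) (smul_nonneg hc' (posPart_nonneg _)),
        hsmul _ _ hc' (posPart_nonneg _), hsmul _ _ hc' (negPart_nonneg _)]
      ring
  · intro f hf
    have h0 : σ 0 = 0 := by simpa using hsmul 0 0 le_rfl le_rfl
    have := key f 0 hf le_rfl
    rw [sub_zero, h0, sub_zero] at this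
    exact this

/-- A linear functional that lies above an order bounded one on the positive cone is itself order
bounded: the difference is monotone, hence bounded on `[a, b]` by its values at `a` and `b`. -/
theorem mem_orderBoundedFunctionals_of_le (L : E →ₗ[ℝ] ℝ) (α : RieszOrderDual E)
    (h : ∀ f, 0 ≤ f → α.1 f ≤ L f) : L ∈ orderBoundedFunctionals E := by
  intro a b
  obtain ⟨C, hC⟩ := α.2 a b
  refine ⟨C + |L a - α.1 a| + |L b - α.1 b|, fun f hf => ?_⟩
  have h₁ := h (f - a) (sub_nonneg.2 hf.1)
  have h₂ := h (b - f) (sub_nonneg.2 hf.2)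
  rw [map_sub, map_sub] at h₁ h₂
  have h₃ := abs_le.1 (hC f hf)
  have h₄ := neg_abs_le (L a - α.1 a)
  have h₅ := le_abs_self (L b - α.1 b)
  have h₆ := abs_nonneg (L a - α.1 a)
  have h₇ := abs_nonneg (L b - α.1 b)
  rw [abs_le]
  constructor <;> linarith

namespace DecompSum

variable {S : Set (RieszOrderDual E)}

theorem nonneg {f : E} {r : ℝ} (h : DecompSum S f r) : 0 ≤ f := by
  induction h with
  | nil => exact le_rfl
  | cons _ hf _ ih => exact add_nonneg hf ih

/-- The Riesz decomposition property: a decomposition of `h` splits along `0 ≤ f ≤ h`. -/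
theorem split {h : E} {r : ℝ} (hr : DecompSum S h r) :
    ∀ f, 0 ≤ f → f ≤ h → ∃ s t, DecompSum S f s ∧ DecompSum S (h - f) t ∧ r = s + t := by
  induction hr with
  | nil =>
    intro f h0 h1
    obtain rfl := le_antisymm h1 h0
    exact ⟨0, 0, nil, by simpa using nil, by simp⟩
  | @cons α a g r hα ha _ ih =>
    intro f h0 h1
    -- Of `f`, the part `f ⊓ a` is taken from `a`, and the rest is left to the induction hypothesis.
    have hle : f - f ⊓ a ≤ g := by
      rw [sub_le_iff_le_add', ← sub_le_iff_le_add, le_inf_iff]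
      refine ⟨sub_le_self f ?_, sub_le_iff_le_add.2 h1⟩
      exact DecompSum.nonneg ‹_›
    obtain ⟨s, t, hs, ht, rfl⟩ := ih (f - f ⊓ a) (sub_nonneg.2 inf_le_left) hle
    refine ⟨α.1 (f ⊓ a) + s, α.1 (a - f ⊓ a) + t, ?_, ?_, ?_⟩
    · simpa using cons hα (le_inf h0 ha) hs
    · have := cons hα (sub_nonneg.2 (inf_le_right : f ⊓ a ≤ a)) ht
      convert this using 1
      abel
    · rw [map_sub]
      ring

theorem le_of_mem_upperBounds {β : RieszOrderDual E} (hβ : β ∈ upperBounds S) {f : E} {r : ℝ}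
    (h : DecompSum S f r) : r ≤ β.1 f := by
  induction h with
  | nil => simp
  | cons hα hf _ ih =>
    rw [map_add]
    exact add_le_add (hβ hα _ hf) ih

/-- For two functionals a decomposition can be grouped into two pieces, one for each. -/
theorem exists_of_pair {α β : RieszOrderDual E} {f : E} {r : ℝ} (h : DecompSum {α, β} f r) :
    ∃ g, 0 ≤ g ∧ g ≤ f ∧ r = α.1 g + β.1 (f - g) := by
  induction h with
  | nil => exact ⟨0, le_rfl, le_rfl, by simp⟩
  | @cons γ a g r hγ ha _ ih =>
    obtain ⟨b, hb, hbg, rfl⟩ := ih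
    rcases hγ with rfl | rfl
    · exact ⟨a + b, add_nonneg ha hb, add_le_add_right hbg a, by
        rw [add_sub_add_left_eq_sub, map_add]; ring⟩
    · exact ⟨b, hb, hbg.trans (le_add_of_nonneg_left ha), by
        rw [add_sub_assoc, map_add]; ring⟩

end DecompSum

/-- The Riesz–Kantorovich formula: if the sums `α₁ f₁ + ⋯ + αₙ fₙ` over the decompositions of each
`f ≥ 0` are bounded above, then their suprema define the least upper bound of `S`. -/
theorem exists_isLUB_of_decompSum [PosSMulMono ℝ E] {S : Set (RieszOrderDual E)}
    (hS : S.Nonempty) (hb : ∀ f, 0 ≤ f → BddAbove {r | DecompSum S f r}) : ∃ s, IsLUB S s := by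
  obtain ⟨α₀, hα₀⟩ := hS
  have hne : ∀ f : E, 0 ≤ f → {r | DecompSum S f r}.Nonempty := fun f hf =>
    ⟨_, DecompSum.single hα₀ hf⟩
  have hle : ∀ {f : E} {r : ℝ}, DecompSum S f r → r ≤ sSup {r | DecompSum S f r} := fun h =>
    le_csSup (hb _ h.nonneg) h
  obtain ⟨L, hL⟩ := exists_linearMap_of_additive_on_cone
    (fun f : E => sSup {r | DecompSum S f r}) (by
      intro f g hf hg
      apply le_antisymm
      · refine csSup_le (hne _ (add_nonneg hf hg)) fun r hr => ?_
        obtain ⟨s, t, hs, ht, rfl⟩ := hr.split f hf (le_add_of_nonneg_right hg)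
        rw [add_sub_cancel_left] at ht
        exact add_le_add (hle hs) (hle ht)
      · rw [← le_sub_iff_add_le]
        refine csSup_le (hne f hf) fun r hr => ?_
        rw [le_sub_comm]
        refine csSup_le (hne g hg) fun s hs => ?_
        rw [le_sub_iff_add_le']
        exact hle (hr.add hs)) (by
      have hmul : ∀ (c : ℝ) (f : E), 0 ≤ c → 0 ≤ f →
          c * sSup {r | DecompSum S f r} ≤ sSup {r | DecompSum S (c • f) r} := by
        intro c f hc hf
        rw [← smul_eq_mul, ← Real.sSup_smul_of_nonneg hc]
        refine csSup_le ((hne f hf).smul_set) ?_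
        rintro _ ⟨r, hr, rfl⟩
        exact hle (DecompSum.smul hc hr)
      intro c f hc hf
      refine le_antisymm ?_ (hmul c f hc hf)
      rcases hc.eq_or_lt with rfl | hc
      · refine csSup_le (hne _ (by simp)) fun r hr => ?_
        obtain ⟨B, hB⟩ := hb 0 le_rfl
        rw [zero_smul] at hr
        rw [zero_mul]
        -- The sums for `f = 0` form a bounded cone in `ℝ`.
        by_contra! hpos
        have hn : 0 ≤ (B + 1) / r := by
          have : (0 : ℝ) ≤ B := hB DecompSum.nil
          positivity
        have := hB (show DecompSum S 0 _ by simpa using DecompSum.smul hn hr)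
        rw [div_mul_cancel₀ _ hpos.ne'] at this
        linarith
      · have := hmul c⁻¹ (c • f) (inv_nonneg.2 hc.le) (smul_nonneg hc.le hf)
        rwa [inv_smul_smul₀ hc.ne', inv_mul_le_iff₀ hc] at this)
  have hαL : ∀ α ∈ S, ∀ f, 0 ≤ f → α.1 f ≤ L f := fun α hα f hf => by
    rw [hL f hf]
    exact hle (DecompSum.single hα hf)
  refine ⟨⟨L, mem_orderBoundedFunctionals_of_le L α₀ (hαL α₀ hα₀)⟩, hαL, fun β hβ f hf => ?_⟩
  change L f ≤ β.1 f
  rw [hL f hf]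
  exact csSup_le (hne f hf) fun r hr => hr.le_of_mem_upperBounds hβ

theorem exists_isLUB_pair [PosSMulMono ℝ E] (α β : RieszOrderDual E) :
    ∃ s, IsLUB {α, β} s := by
  -- By order boundedness on `[0, f]`, the sums `α g + β (f - g)` with `0 ≤ g ≤ f` are bounded.
  refine exists_isLUB_of_decompSum ⟨α, by simp⟩ fun f _ => ?_
  obtain ⟨C, hC⟩ := α.2 0 f
  obtain ⟨D, hD⟩ := β.2 0 f
  refine ⟨C + D, fun r hr => ?_⟩
  obtain ⟨g, h0, h1, rfl⟩ := hr.exists_of_pair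
  exact add_le_add (le_of_abs_le (hC g ⟨h0, h1⟩))
    (le_of_abs_le (hD (f - g) ⟨sub_nonneg.2 h1, sub_le_self f h0⟩))

theorem exists_isLUB_of_bddAbove [PosSMulMono ℝ E] {S : Set (RieszOrderDual E)}
    (hS : S.Nonempty) (hb : BddAbove S) : ∃ s, IsLUB S s := by
  obtain ⟨β, hβ⟩ := hb
  exact exists_isLUB_of_decompSum hS fun f _ => ⟨β.1 f, fun r hr => hr.le_of_mem_upperBounds hβ⟩

instance : IsOrderedAddMonoid (RieszOrderDual E) where
  add_le_add_left _ _ h γ f hf := add_le_add_left (h f hf) (γ.1 f)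

/-- The order dual of a Riesz space is a Riesz space. -/
theorem isRieszSpace_orderDual [PosSMulMono ℝ E] : IsRieszSpace (RieszOrderDual E) where
  add_le_add a b c h := add_le_add_left h c
  smul_nonneg r a hr ha f hf := mul_nonneg hr (ha f hf)
  exists_sup := exists_isLUB_pair
  exists_inf a b := by
    obtain ⟨s, hs⟩ := exists_isLUB_pair (-a) (-b)
    exact ⟨-s, isLUB_neg.1 (by simpa using hs)⟩

/-- The order dual of a Riesz space is Dedekind complete. -/
theorem isDedekindComplete_orderDual [PosSMulMono ℝ E] :
    IsDedekindComplete (RieszOrderDual E) := by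
  refine ⟨fun S => exists_isLUB_of_bddAbove, fun S hS hb => ?_⟩
  obtain ⟨s, hs⟩ := exists_isLUB_of_bddAbove hS.neg hb.neg
  exact ⟨-s, isLUB_neg.1 (by simpa using hs)⟩

end OrderDual

/-! ### Automatic continuity of positive functionals -/

/-- Positive functionals on a Banach lattice are bounded: otherwise there are `fₙ ≥ 0` with
`‖fₙ‖ ≤ 2⁻ⁿ` and `L fₙ > n`, and `L` has no finite value at `∑ fₙ`. -/
theorem exists_bound_of_nonneg {E : Type*} [NormedAddCommGroup E] [NormedSpace ℝ E]
    [CompleteSpace E] [Lattice E] [IsOrderedAddMonoid E] [HasSolidNorm E] [PosSMulMono ℝ E]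
    [OrderClosedTopology E] (L : E →ₗ[ℝ] ℝ) (hL : ∀ f, 0 ≤ f → 0 ≤ L f) :
    ∃ C, 0 ≤ C ∧ ∀ f, 0 ≤ f → L f ≤ C * ‖f‖ := by
  by_contra! H
  have H' : ∀ n : ℕ, ∃ f : E, 0 ≤ f ∧ ‖f‖ ≤ (1 / 2 : ℝ) ^ n ∧ (n : ℝ) < L f := by
    intro n
    obtain ⟨f, hf, hlt⟩ := H (n * 2 ^ n) (by positivity)
    have hf0 : 0 < ‖f‖ := by
      rw [norm_pos_iff]
      rintro rfl
      simp at hlt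
    refine ⟨((1 / 2 : ℝ) ^ n * ‖f‖⁻¹) • f, smul_nonneg (by positivity) hf, ?_, ?_⟩
    · rw [norm_smul, Real.norm_of_nonneg (by positivity), mul_assoc, inv_mul_cancel₀ hf0.ne',
        mul_one]
    · rw [map_smul, smul_eq_mul, one_div, inv_pow, ← mul_inv, ← div_eq_inv_mul,
        lt_div_iff₀ (by positivity), ← mul_assoc]
      exact hlt
  choose f hf0 hfn hfL using H'
  have hs : Summable f := Summable.of_norm_bounded summable_geometric_two hfn
  obtain ⟨n, hn⟩ := exists_nat_gt (L (∑' i, f i))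
  have h := hL _ (sub_nonneg.2 (hs.le_tsum n fun j _ => hf0 j))
  rw [map_sub] at h
  linarith [hfL n]

theorem continuous_of_nonneg {E : Type*} [NormedAddCommGroup E] [NormedSpace ℝ E]
    [CompleteSpace E] [Lattice E] [IsOrderedAddMonoid E] [HasSolidNorm E] [PosSMulMono ℝ E]
    [OrderClosedTopology E] (L : E →ₗ[ℝ] ℝ) (hL : ∀ f, 0 ≤ f → 0 ≤ L f) : Continuous L := by
  obtain ⟨C, hC0, hC⟩ := exists_bound_of_nonneg L hL
  refine AddMonoidHomClass.continuous_of_bound L C fun f => ?_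
  have h₁ := hL _ (sub_nonneg.2 (le_abs_self f))
  have h₂ := hL _ (sub_nonneg.2 (neg_le_abs f))
  have h₃ := hC |f| (abs_nonneg f)
  rw [norm_abs_eq_norm] at h₃
  rw [map_sub] at h₁
  rw [map_sub, map_neg] at h₂
  rw [Real.norm_eq_abs, abs_le]
  constructor <;> linarith

/-! ### Restriction to a set, and the positivity of `Φ` -/

section Lp

variable {X : Type*} [MeasurableSpace X] {μ : Measure X}

instance {p : ENNReal} : PosSMulMono ℝ (Lp ℝ p μ) where
  smul_le_smul_of_nonneg_left r hr f g hfg := by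
    rw [← Lp.coeFn_le] at hfg ⊢
    filter_upwards [hfg, Lp.coeFn_smul r f, Lp.coeFn_smul r g] with x hx hf hg
    rw [hf, hg]
    exact mul_le_mul_of_nonneg_left hx hr

/-- The map `g ↦ 1_A g` from `L^p` to `L^q`, for `A` such that `1_A g ∈ L^q` for all `g ∈ L^p`. -/
noncomputable def indicatorMap (p q : ENNReal) (A : Set X)
    (h : ∀ g : Lp ℝ p μ, MemLp (A.indicator g) q μ) : Lp ℝ p μ →ₗ[ℝ] Lp ℝ q μ where
  toFun g := (h g).toLp _
  map_add' f g := by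
    rw [← MemLp.toLp_add, MemLp.toLp_eq_toLp_iff]
    filter_upwards [Lp.coeFn_add f g] with x hx
    change A.indicator (f + g : Lp ℝ p μ) x = A.indicator f x + A.indicator g x
    by_cases hxA : x ∈ A
    · simp only [Set.indicator_of_mem hxA]
      exact hx
    · simp only [Set.indicator_of_notMem hxA, add_zero]
  map_smul' r f := by
    rw [RingHom.id_apply, ← MemLp.toLp_const_smul, MemLp.toLp_eq_toLp_iff]
    filter_upwards [Lp.coeFn_smul r f] with x hx
    by_cases hxA : x ∈ A <;> simp [hxA, hx]

theorem coeFn_indicatorMap {p q : ENNReal} {A : Set X}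
    (h : ∀ g : Lp ℝ p μ, MemLp (A.indicator g) q μ) (g : Lp ℝ p μ) :
    indicatorMap p q A h g =ᵐ[μ] A.indicator g :=
  (h g).coeFn_toLp

theorem indicatorMap_nonneg {p q : ENNReal} {A : Set X}
    (h : ∀ g : Lp ℝ p μ, MemLp (A.indicator g) q μ) {g : Lp ℝ p μ} (hg : 0 ≤ g) :
    0 ≤ indicatorMap p q A h g := by
  rw [← Lp.coeFn_nonneg] at hg ⊢
  filter_upwards [hg, coeFn_indicatorMap h g] with x hx hx'
  rw [hx']
  exact Set.indicator_nonneg (fun _ _ => hx) x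

theorem memLp_indicator {p : ENNReal} {A : Set X} (hA : MeasurableSet A) (g : Lp ℝ p μ) :
    MemLp (A.indicator g) p μ :=
  (Lp.memLp g).indicator hA

theorem Phi_apply (h : Lp ℝ ⊤ μ) (f : Lp ℝ 1 μ) : (Phi μ h).1 f = ∫ x, f x * h x ∂μ := rfl

theorem Phi_nonneg {h : Lp ℝ ⊤ μ} (hh : 0 ≤ h) : 0 ≤ Phi μ h := by
  intro f hf
  refine integral_nonneg_of_ae ?_
  filter_upwards [(Lp.coeFn_nonneg h).2 hh, (Lp.coeFn_nonneg f).2 hf] with x hx hx'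
  exact mul_nonneg hx' hx

theorem Phi_mono {g h : Lp ℝ ⊤ μ} (hgh : g ≤ h) : Phi μ g ≤ Phi μ h := by
  have := Phi_nonneg (sub_nonneg.2 hgh)
  rwa [map_sub, sub_nonneg] at this

theorem Phi_indicatorConstLp (h : Lp ℝ ⊤ μ) {B : Set X} (hB : MeasurableSet B) (hμB : μ B ≠ ⊤) :
    (Phi μ h).1 (indicatorConstLp 1 hB hμB 1) = ∫ x in B, h x ∂μ := by
  rw [Phi_apply, ← integral_indicator hB]
  refine integral_congr_ae ?_
  filter_upwards [indicatorConstLp_coeFn (p := 1) (hs := hB) (hμs := hμB) (c := (1 : ℝ))]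
    with x hx
  rw [hx]
  by_cases hxB : x ∈ B <;> simp [hxB]

theorem indicatorConstLp_nonneg {B : Set X} (hB : MeasurableSet B) (hμB : μ B ≠ ⊤) {c : ℝ}
    (hc : 0 ≤ c) : 0 ≤ indicatorConstLp 1 hB hμB c := by
  rw [← Lp.coeFn_nonneg]
  filter_upwards [indicatorConstLp_coeFn (p := 1) (hs := hB) (hμs := hμB) (c := c)] with x hx
  rw [hx]
  exact Set.indicator_nonneg (fun _ _ => hc) x

/-- On a semi-finite measure space `Φ` reflects positivity: were `h < 0` on a set of positive
measure, then `φ_h` would be negative at the indicator of a subset of finite positive measure. -/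
theorem nonneg_of_Phi_nonneg (hμ : IsSemifinite μ) {h : Lp ℝ ⊤ μ} (hh : 0 ≤ Phi μ h) :
    0 ≤ h := by
  rw [← Lp.coeFn_nonneg]
  by_contra hneg
  have hm : MeasurableSet {x | h x < 0} :=
    (Lp.stronglyMeasurable h).measurable measurableSet_Iio
  have hpos : μ {x | h x < 0} ≠ 0 := by
    simpa [Filter.EventuallyLE, ae_iff] using hneg
  obtain ⟨B, hB, hBsub, hB0, hBtop⟩ : ∃ B, MeasurableSet B ∧ B ⊆ {x | h x < 0} ∧
      0 < μ B ∧ μ B < ⊤ := by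
    by_cases htop : μ {x | h x < 0} = ⊤
    · exact hμ _ hm htop
    · exact ⟨_, hm, subset_rfl, pos_iff_ne_zero.2 hpos, lt_top_iff_ne_top.2 htop⟩
  have hint : IntegrableOn h B μ := by
    have : IsFiniteMeasure (μ.restrict B) := ⟨by simpa using hBtop⟩
    exact ((Lp.memLp h).restrict B).integrable le_top
  have hae : 0 ≤ᵐ[μ.restrict B] h := by
    refine ae_nonneg_restrict_of_forall_setIntegral_nonneg_inter hint fun s hs hsB => ?_
    rw [← Phi_indicatorConstLp h (hs.inter hB) hsB.ne]
    exact hh _ (indicatorConstLp_nonneg _ _ zero_le_one)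
  rw [Filter.EventuallyLE, ae_restrict_iff' hB] at hae
  refine hB0.ne' (measure_mono_null (fun x hx => ?_) hae)
  exact fun hx' => absurd (hx' hx) (not_le.2 (hBsub hx))

theorem Phi_le_Phi_iff (hμ : IsSemifinite μ) {g h : Lp ℝ ⊤ μ} : Phi μ g ≤ Phi μ h ↔ g ≤ h := by
  refine ⟨fun H => ?_, Phi_mono⟩
  rw [← sub_nonneg, ← map_sub] at H
  exact sub_nonneg.1 (nonneg_of_Phi_nonneg hμ H)

theorem Phi_injective (hμ : IsSemifinite μ) : Function.Injective (Phi μ) := fun _ _ H =>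
  le_antisymm ((Phi_le_Phi_iff hμ).1 H.le) ((Phi_le_Phi_iff hμ).1 H.ge)

/-- `Φ` preserves binary suprema: on `{h ≤ g}` the function `g ⊔ h` is `g`, and on the complement
it is `h`. -/
theorem isLUB_Phi_sup (g h : Lp ℝ ⊤ μ) : IsLUB {Phi μ g, Phi μ h} (Phi μ (g ⊔ h)) := by
  constructor
  · rintro _ (rfl | rfl)
    · exact Phi_mono le_sup_left
    · exact Phi_mono le_sup_right
  · intro β hβ f hf
    have hP : MeasurableSet {x | h x ≤ g x} :=
      measurableSet_le (Lp.stronglyMeasurable h).measurable (Lp.stronglyMeasurable g).measurable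
    set P := {x | h x ≤ g x} with hPdef
    set f₁ := indicatorMap 1 1 P (memLp_indicator hP) f with hf₁
    set f₂ := indicatorMap 1 1 Pᶜ (memLp_indicator hP.compl) f with hf₂
    have hsum : f₁ + f₂ = f := by
      apply Lp.ext
      filter_upwards [Lp.coeFn_add f₁ f₂, coeFn_indicatorMap (memLp_indicator hP) f,
        coeFn_indicatorMap (memLp_indicator hP.compl) f] with x h₁ h₂ h₃
      rw [h₁, Pi.add_apply, h₂, h₃]
      exact congrFun (Set.indicator_self_add_compl P f) x
    have hval : (Phi μ (g ⊔ h)).1 f = (Phi μ g).1 f₁ + (Phi μ h).1 f₂ := by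
      rw [Phi_apply, Phi_apply, Phi_apply, ← integral_add (integrable_mul _ _) (integrable_mul _ _)]
      refine integral_congr_ae ?_
      filter_upwards [Lp.coeFn_sup g h, coeFn_indicatorMap (memLp_indicator hP) f,
        coeFn_indicatorMap (memLp_indicator hP.compl) f] with x h₁ h₂ h₃
      rw [h₁, h₂, h₃, Pi.sup_apply]
      by_cases hx : h x ≤ g x
      · simp [hPdef, hx]
      · simp [hPdef, hx, (not_le.1 hx).le]
    rw [hval, ← hsum, map_add]
    exact add_le_add (hβ (by simp) _ (indicatorMap_nonneg _ hf))
      (hβ (by simp) _ (indicatorMap_nonneg _ hf))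

theorem isGLB_Phi_inf (g h : Lp ℝ ⊤ μ) : IsGLB {Phi μ g, Phi μ h} (Phi μ (g ⊓ h)) := by
  have H := isLUB_Phi_sup (-g) (-h)
  rw [← neg_inf, map_neg, map_neg, map_neg] at H
  rw [← neg_neg (Phi μ (g ⊓ h)), ← isLUB_neg]
  simpa using H

theorem isRieszHom_Phi : IsRieszHom (Phi μ) where
  map_sup a b s hs := by
    rw [hs.unique isLUB_pair]
    exact isLUB_Phi_sup a b
  map_inf a b s hs := by
    rw [hs.unique isGLB_pair]
    exact isGLB_Phi_inf a b

theorem isRieszSubspace_range_Phi : IsRieszSubspace (LinearMap.range (Phi μ)) where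
  sup_mem := by
    rintro _ ⟨a, rfl⟩ _ ⟨b, rfl⟩
    exact ⟨_, ⟨a ⊔ b, rfl⟩, isLUB_Phi_sup a b⟩
  inf_mem := by
    rintro _ ⟨a, rfl⟩ _ ⟨b, rfl⟩
    exact ⟨_, ⟨a ⊓ b, rfl⟩, isGLB_Phi_inf a b⟩

theorem isRieszSpace_Lp_top : IsRieszSpace (Lp ℝ ⊤ μ) where
  add_le_add _ _ c h := add_le_add_left h c
  smul_nonneg _ _ hr ha := smul_nonneg hr ha
  exists_sup a b := ⟨a ⊔ b, isLUB_pair⟩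
  exists_inf a b := ⟨a ⊓ b, isGLB_pair⟩

/-! ### The range of `Φ` is majorizing and order dense -/

/-- Every functional on `L^1` lies below its positive part, which by boundedness lies below a
multiple of the integral, and the multiples of the integral are the images of the constants. -/
theorem isMajorizing_range_Phi : IsMajorizing (LinearMap.range (Phi μ)) := by
  intro α
  obtain ⟨β, hβ⟩ := exists_isLUB_pair α 0
  have hβ0 : 0 ≤ β := hβ.1 (by simp)
  obtain ⟨C, -, hC⟩ := exists_bound_of_nonneg β.1 hβ0
  have hmem : MemLp (fun _ : X => C) ⊤ μ := memLp_top_const C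
  refine ⟨_, ⟨hmem.toLp _, rfl⟩, (hβ.1 (by simp) : α ≤ β).trans fun f hf => (hC f hf).trans_eq ?_⟩
  rw [Phi_apply, L1.norm_eq_integral_norm, ← integral_const_mul]
  refine integral_congr_ae ?_
  filter_upwards [(Lp.coeFn_nonneg f).2 hf, hmem.coeFn_toLp] with x hx hx'
  rw [hx', Real.norm_of_nonneg hx, mul_comm]

/-- Continuous functionals on `L^1` that agree at the indicators of sets of finite measure are
equal. -/
theorem ext_of_indicatorConstLp {α β : Lp ℝ 1 μ →ₗ[ℝ] ℝ} (hα : Continuous α) (hβ : Continuous β)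
    (h : ∀ (B : Set X) (hB : MeasurableSet B) (hμB : μ B ≠ ⊤),
      α (indicatorConstLp 1 hB hμB 1) = β (indicatorConstLp 1 hB hμB 1)) : α = β := by
  ext f
  refine Lp.induction ENNReal.one_ne_top (fun f => α f = β f) ?_ ?_ (isClosed_eq hα hβ) f
  · intro c B hB hμB
    rw [Lp.simpleFunc.coe_indicatorConst]
    have : indicatorConstLp 1 hB hμB.ne c = c • indicatorConstLp 1 hB hμB.ne (1 : ℝ) := by
      apply Lp.ext
      filter_upwards [indicatorConstLp_coeFn (p := 1) (hs := hB) (hμs := hμB.ne) (c := c),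
        indicatorConstLp_coeFn (p := 1) (hs := hB) (hμs := hμB.ne) (c := (1 : ℝ)),
        Lp.coeFn_smul c (indicatorConstLp 1 hB hμB.ne (1 : ℝ))] with x h₁ h₂ h₃
      rw [h₁, h₃, Pi.smul_apply, h₂]
      by_cases hx : x ∈ B <;> simp [hx]
    rw [this, map_smul, map_smul, h]
  · intro f g hf hg _ h₁ h₂
    rw [map_add, map_add, h₁, h₂]

theorem indicatorMap_indicatorConstLp {p q : ENNReal} {A B : Set X}
    (h : ∀ g : Lp ℝ p μ, MemLp (A.indicator g) q μ) (hA : MeasurableSet A) (hB : MeasurableSet B)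
    (hμB : μ B ≠ ⊤) (c : ℝ) :
    indicatorMap p q A h (indicatorConstLp p hB hμB c) =
      indicatorConstLp q (hA.inter hB) (measure_ne_top_of_subset Set.inter_subset_right hμB) c := by
  apply Lp.ext
  filter_upwards [coeFn_indicatorMap h (indicatorConstLp p hB hμB c),
    indicatorConstLp_coeFn (p := p) (hs := hB) (hμs := hμB) (c := c),
    indicatorConstLp_coeFn (p := q) (hs := hA.inter hB)
      (hμs := measure_ne_top_of_subset Set.inter_subset_right hμB) (c := c)] with x h₁ h₂ h₃
  rw [h₁, h₃, ← Set.indicator_indicator]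
  by_cases hx : x ∈ A <;> simp [hx, h₂]

/-- A positive functional on `L^1` is, on a set `A` of finite measure, given by a function in
`L^∞`: the Riesz representation theorem in `L^2` applies to `g ↦ α (1_A g)`, and the resulting
`k ∈ L^2` is bounded on `A` because `0 ≤ α ≤ C ∫`. -/
theorem exists_Phi_eq_on_finite {α : RieszOrderDual (Lp ℝ 1 μ)} (hα : 0 ≤ α) {A : Set X}
    (hA : MeasurableSet A) (hμA : μ A ≠ ⊤) :
    ∃ h : Lp ℝ ⊤ μ, ∀ f, (Phi μ h).1 f = α.1 (indicatorMap 1 1 A (memLp_indicator hA) f) := by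
  have h21 : ∀ g : Lp ℝ 2 μ, MemLp (A.indicator g) 1 μ := fun g =>
    ((Lp.memLp g).indicator hA).mono_exponent_of_measure_support_ne_top
      (fun x hx => Set.indicator_of_notMem hx _) hμA (by norm_num)
  let L : Lp ℝ 2 μ →ₗ[ℝ] ℝ := α.1 ∘ₗ indicatorMap 2 1 A h21
  have hL : Continuous L := continuous_of_nonneg L fun f hf => hα _ (indicatorMap_nonneg h21 hf)
  let k : Lp ℝ 2 μ := (InnerProductSpace.toDual ℝ (Lp ℝ 2 μ)).symm ⟨L, hL⟩
  have hk : ∀ (B : Set X) (hB : MeasurableSet B) (hμB : μ B ≠ ⊤), ∫ x in B, k x ∂μ =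
      α.1 (indicatorConstLp 1 (hA.inter hB)
        (measure_ne_top_of_subset Set.inter_subset_right hμB) 1) := by
    intro B hB hμB
    rw [← L2.inner_indicatorConstLp_one (𝕜 := ℝ) hB hμB k, real_inner_comm]
    have : inner ℝ k (indicatorConstLp 2 hB hμB (1 : ℝ)) = L (indicatorConstLp 2 hB hμB (1 : ℝ)) :=
      InnerProductSpace.toDual_symm_apply
    rw [this, ← indicatorMap_indicatorConstLp h21 hA hB hμB]
    rfl
  obtain ⟨C, hC0, hC⟩ := exists_bound_of_nonneg α.1 hα
  have hfin : IsFiniteMeasure (μ.restrict A) := ⟨by simpa using hμA.lt_top⟩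
  have hkint : IntegrableOn k A μ := ((Lp.memLp k).restrict A).integrable (by norm_num)
  have hk0 : 0 ≤ᵐ[μ.restrict A] k := by
    refine ae_nonneg_restrict_of_forall_setIntegral_nonneg_inter hkint fun s hs hsA => ?_
    rw [hk _ (hs.inter hA) hsA.ne]
    exact hα _ (indicatorConstLp_nonneg _ _ zero_le_one)
  have hkC : 0 ≤ᵐ[μ.restrict A] fun x => C - k x := by
    refine ae_nonneg_restrict_of_forall_setIntegral_nonneg_inter
      ((integrable_const C).sub hkint) fun s hs hsA => ?_
    have hci : IntegrableOn (fun _ => C) (s ∩ A) μ := integrableOn_const hsA.ne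
    rw [integral_sub hci (hkint.mono_set Set.inter_subset_right), hk _ (hs.inter hA) hsA.ne,
      sub_nonneg]
    refine (hC _ (indicatorConstLp_nonneg _ _ zero_le_one)).trans ?_
    rw [norm_indicatorConstLp one_ne_zero ENNReal.one_ne_top, setIntegral_const]
    simp only [norm_one, ENNReal.toReal_one, div_one, Real.rpow_one, one_mul, smul_eq_mul]
    rw [mul_comm]
    refine mul_le_mul_of_nonneg_right ?_ hC0
    exact measureReal_mono Set.inter_subset_right hsA.ne
  have hmem : MemLp (A.indicator k) ⊤ μ := by
    refine memLp_top_of_bound ((Lp.stronglyMeasurable k).indicator hA).aestronglyMeasurable C ?_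
    rw [Filter.EventuallyLE, ae_restrict_iff' hA] at hk0 hkC
    filter_upwards [hk0, hkC] with x h₁ h₂
    by_cases hx : x ∈ A
    · rw [Set.indicator_of_mem hx, Real.norm_of_nonneg (h₁ hx)]
      exact sub_nonneg.1 (h₂ hx)
    · simpa [hx] using hC0
  have hh : 0 ≤ hmem.toLp _ := by
    rw [← Lp.coeFn_nonneg]
    rw [Filter.EventuallyLE, ae_restrict_iff' hA] at hk0
    filter_upwards [hk0, hmem.coeFn_toLp] with x h₁ h₂
    rw [h₂]
    exact Set.indicator_apply_nonneg h₁
  refine ⟨hmem.toLp _, fun f => ?_⟩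
  have heq : (Phi μ (hmem.toLp _)).1 = α.1 ∘ₗ indicatorMap 1 1 A (memLp_indicator hA) := by
    refine ext_of_indicatorConstLp (continuous_of_nonneg _ (Phi_nonneg hh))
      (continuous_of_nonneg _ fun f hf => hα _ (indicatorMap_nonneg _ hf)) fun B hB hμB => ?_
    have hAB : μ (A ∩ B) ≠ ⊤ := measure_ne_top_of_subset Set.inter_subset_right hμB
    rw [Phi_indicatorConstLp, LinearMap.comp_apply, indicatorMap_indicatorConstLp _ hA hB hμB,
      integral_congr_ae (ae_restrict_of_ae hmem.coeFn_toLp), setIntegral_indicator hA,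
      hk _ (hB.inter hA) (by rwa [Set.inter_comm])]
    congr 2
    rw [Set.inter_comm B A, ← Set.inter_assoc, Set.inter_self]
  exact DFunLike.congr_fun heq f

/-- A functional `α > 0` is positive at the indicator of some `A` of finite measure, and
`f ↦ α (1_A f)` is then a nonzero functional below `α` in the range of `Φ`. -/
theorem isOrderDense_range_Phi : IsOrderDense (LinearMap.range (Phi μ)) := by
  intro α hα
  have hα0 : 0 ≤ α := hα.le
  obtain ⟨A, hA, hμA, hne⟩ : ∃ (A : Set X) (hA : MeasurableSet A) (hμA : μ A ≠ ⊤),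
      α.1 (indicatorConstLp 1 hA hμA 1) ≠ 0 := by
    by_contra! H
    refine hα.ne' (Subtype.ext ?_)
    exact ext_of_indicatorConstLp (continuous_of_nonneg _ hα0) continuous_zero fun B hB hμB =>
      H B hB hμB
  obtain ⟨h, hh⟩ := exists_Phi_eq_on_finite hα0 hA hμA
  refine ⟨_, ⟨h, rfl⟩, lt_of_le_of_ne (fun f hf => ?_) ?_, fun f hf => ?_⟩
  · rw [hh]
    exact hα0 _ (indicatorMap_nonneg _ hf)
  · intro H
    have := hh (indicatorConstLp 1 hA hμA 1)
    rw [← H, indicatorMap_indicatorConstLp _ hA hA hμA] at this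
    refine hne (Eq.trans ?_ this.symm)
    congr 2
    rw [Set.inter_self]
  · rw [hh, ← sub_nonneg, ← map_sub]
    refine hα0 _ ?_
    rw [← Lp.coeFn_nonneg]
    filter_upwards [Lp.coeFn_sub f (indicatorMap 1 1 A (memLp_indicator hA) f),
      coeFn_indicatorMap (memLp_indicator hA) f, (Lp.coeFn_nonneg f).2 hf] with x h₁ h₂ h₃
    rw [h₁, Pi.sub_apply, h₂, Pi.zero_apply, sub_nonneg]
    exact Set.indicator_apply_le' (fun _ => le_rfl) fun _ => h₃

theorem isDedekindCompletion_Phi (hμ : IsSemifinite μ) : IsDedekindCompletion (Phi μ) where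
  source_riesz := isRieszSpace_Lp_top
  target_riesz := isRieszSpace_orderDual
  target_complete := isDedekindComplete_orderDual
  injective := Phi_injective hμ
  riesz_hom := isRieszHom_Phi
  range_riesz := isRieszSubspace_range_Phi
  range_dense := isOrderDense_range_Phi
  range_majorizing := isMajorizing_range_Phi

/-! ### Surjectivity of `Φ` and Dedekind completeness of `L^∞` -/

theorem isDedekindComplete_of_surjective (hμ : IsSemifinite μ)
    (hs : Function.Surjective (Phi μ)) : IsDedekindComplete (Lp ℝ ⊤ μ) := by
  let e : Lp ℝ ⊤ μ ≃o RieszOrderDual (Lp ℝ 1 μ) :=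
    { Equiv.ofBijective (Phi μ) ⟨Phi_injective hμ, hs⟩ with
      map_rel_iff' := Phi_le_Phi_iff hμ }
  refine ⟨fun S hS hb => ?_, fun S hS hb => ?_⟩
  · obtain ⟨s, hs⟩ := isDedekindComplete_orderDual.1 (e '' S) (hS.image e)
      (e.monotone.map_bddAbove hb)
    exact ⟨_, e.isLUB_image.1 hs⟩
  · obtain ⟨s, hs⟩ := isDedekindComplete_orderDual.2 (e '' S) (hS.image e)
      (e.monotone.map_bddBelow hb)
    exact ⟨_, e.isGLB_image.1 hs⟩

/-- If `L^∞` is Dedekind complete, then `α = Φ s` for `s = sup {h | Φ h ≤ α}`. Both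
`sup {Φ h | Φ h ≤ α} < α` and `α < Φ s` are excluded by order density: an `h > 0` with `Φ h` below
the difference would make `s - h` an upper bound of `{h | Φ h ≤ α}`. -/
theorem surjective_of_isDedekindComplete (hμ : IsSemifinite μ)
    (hc : IsDedekindComplete (Lp ℝ ⊤ μ)) : Function.Surjective (Phi μ) := by
  intro α
  let S : Set (Lp ℝ ⊤ μ) := {h | Phi μ h ≤ α}
  have hSne : S.Nonempty := by
    obtain ⟨_, ⟨u, rfl⟩, hu⟩ := isMajorizing_range_Phi (-α)
    exact ⟨-u, by rw [Set.mem_ofPred_eq, map_neg]; exact neg_le.1 hu⟩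
  have hSb : BddAbove S := by
    obtain ⟨_, ⟨u, rfl⟩, hu⟩ := isMajorizing_range_Phi α
    exact ⟨u, fun h hh => (Phi_le_Phi_iff hμ).1 (le_trans hh hu)⟩
  obtain ⟨s, hs⟩ := hc.1 S hSne hSb
  -- The order density argument, applied below to `γ = α - σ` and to `γ = Φ s - α`.
  have hgap : ∀ γ : RieszOrderDual (Lp ℝ 1 μ), 0 ≤ γ →
      (∀ h, Phi μ h ≤ γ → s - h ∈ upperBounds S) → γ = 0 := by
    intro γ hγ H
    by_contra hne
    obtain ⟨_, ⟨h, rfl⟩, h0, hle⟩ := isOrderDense_range_Phi γ (lt_of_le_of_ne hγ (Ne.symm hne))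
    have h1 : h ≤ 0 := by
      have := hs.2 (H h hle)
      rwa [le_sub_self_iff] at this
    have h2 := Phi_mono h1
    rw [map_zero] at h2
    exact absurd h0 h2.not_gt
  obtain ⟨σ, hσ⟩ := isDedekindComplete_orderDual.1 (Phi μ '' S) (hSne.image _)
    ⟨α, by rintro _ ⟨h, hh, rfl⟩; exact hh⟩
  have hσα : σ ≤ α := hσ.2 (by rintro _ ⟨h, hh, rfl⟩; exact hh)
  have hσs : α = σ := by
    refine sub_eq_zero.1 (hgap _ (sub_nonneg.2 hσα) fun h hh g hg => ?_)
    rw [le_sub_iff_add_le']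
    refine hs.1 ?_
    rw [Set.mem_ofPred_eq, map_add]
    calc Phi μ h + Phi μ g ≤ (α - σ) + σ := add_le_add hh (hσ.1 ⟨g, hg, rfl⟩)
      _ = α := sub_add_cancel α σ
  have hαs : α ≤ Phi μ s := by
    rw [hσs]
    refine hσ.2 ?_
    rintro _ ⟨g, hg, rfl⟩
    exact Phi_mono (hs.1 hg)
  refine ⟨s, sub_eq_zero.1 (hgap _ (sub_nonneg.2 hαs) fun h hh g hg => ?_)⟩
  rw [← Phi_le_Phi_iff hμ, map_sub]
  exact le_trans hg (le_sub_comm.1 hh)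

end Lp

end RieszDual

theorem mainTheorem2 {X : Type*} [MeasurableSpace X] (μ : Measure X)
    (hμ : RieszDual.IsSemifinite μ) :
    RieszDual.IsDedekindCompletion (RieszDual.Phi μ) ∧
      (Function.Surjective (RieszDual.Phi μ) ↔ RieszDual.IsDedekindComplete (Lp ℝ ⊤ μ)) := by
  exact ⟨RieszDual.isDedekindCompletion_Phi hμ,
    RieszDual.isDedekindComplete_of_surjective hμ, RieszDual.surjective_of_isDedekindComplete hμ⟩
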